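/- Let $U\ge 1$ be an integer and $\rho>1$. Consider $U$ urns, all empty at time $0$, evolving in discrete time as follows. Put $w_i=\rho^i$ and $\pi(i,j)=\frac{w_i}{w_i+w_j}$. At time $n$ let $B_n^u$ and $W_n^u=n-B_n^u$ be the numbers of black and of white balls in urn $u$, and let $B_n^*=\sum_u B_n^u$, $W_n^*=\sum_u W_n^u$. Let $(X_n^u)_{n\ge 1,\,1\le u\le U}$ be i.i.d. with $\mathbb{P}[X_n^u=1]=\mathbb{P}[X_n^u=-1]=\frac12$, and let $(V_n^u)_{n\ge 1,\,1\le u\le U}$ be i.i.d. uniform on $[0,1]$, the family $V$ being independent of the family $X$. At each time $n\ge 1$, simultaneously for all urns $u$, one ball of colour $\mathfrak{c}_n^u$ is added to urn $u$: if $X_n^u=1$ (draw from all urns combined), $\mathfrak{c}_n^u$ is black when $V_n^u<\pi(B_{n-1}^*,W_{n-1}^*)$ and white otherwise; if $X_n^u=-1$ (draw from urn $u$ alone), $\mathfrak{c}_n^u$ is black when $V_n^u<\pi(B_{n-1}^u,W_{n-1}^u)$ and white otherwise. (This is the interacting urn mechanism with exponential weights and interaction parameter $p=\frac12$.) Then $$\mathbb{P}\left[\exists\,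 n_0\in\mathbb{N},\ \exists\,\mathfrak{d}\in\{\text{black},\text{white}\}\ \text{such that}\ \forall n\ge n_0,\ \forall u\in\{1,\dots,U\},\ \mathfrak{c}_n^u=\mathfrak{d}\right]=1,$$ that is, almost surely all the balls added to all the urns after some finite random time have the same colour. -/

import Mathlib

open MeasureTheory ProbabilityTheory

namespace InteractingUrns

/-- The two colours of balls. -/
inductive Color where
  | black
  | white

/-- An urn path on `U` urns: `r n u` is the number of black balls in urn `u` at time `n`. All urns
are empty at time `0`, and one ball, black or white, is added to every urn at every step. -/
structure IsUrnPath {U : ℕ} (r : ℕ → Fin U → ℕ) : Prop where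
  zero : ∀ u, r 0 u = 0
  step : ∀ n u, r (n + 1) u = r n u ∨ r (n + 1) u = r n u + 1

/-- Number of white balls in urn `u` at time `n`: each urn holds `n` balls at time `n`
(the subtraction does not truncate for an urn path, see `IsUrnPath.le`). -/
def whiteCount {U : ℕ} (r : ℕ → Fin U → ℕ) (n : ℕ) (u : Fin U) : ℕ := n - r n u

/-- Total number of black balls in all the urns at time `n`. -/
def totalBlack {U : ℕ} (r : ℕ → Fin U → ℕ) (n : ℕ) : ℕ := ∑ u, r n u

/-- Total number of white balls in all the urns at time `n`. -/
def totalWhite {U : ℕ} (r : ℕ → Fin U → ℕ) (n : ℕ) : ℕ := ∑ u, whiteCount r n u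

/-- The colour of the `(n + 1)`-st ball added to urn `u`, that is, of the ball added between the
times `n` and `n + 1`. -/
def addedColor {U : ℕ} (r : ℕ → Fin U → ℕ) (n : ℕ) (u : Fin U) : Color :=
  if r (n + 1) u = r n u + 1 then Color.black else Color.white

/-- `drawProb w i j = w i / (w i + w j)` is the probability of drawing black from `i` black and
`j` white balls under the reinforcement weights `w`. -/
noncomputable def drawProb (w : ℕ → ℝ) (i j : ℕ) : ℝ := w i / (w i + w j)

/-- One step of the interacting urn mechanism. `b u` and `a u` are the current numbers of black and
white balls in urn `u`; the result is the new number of black balls in each urn. Urn `u` draws from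
all the urns combined if `x u = 1`, and from itself alone otherwise (`x u = -1`); the draw is black
iff the uniform variable `v u` falls below the probability of black. -/
noncomputable def urnStep {U : ℕ} (w : ℕ → ℝ) (x : Fin U → ℤ) (v : Fin U → ℝ)
    (b a : Fin U → ℕ) (u : Fin U) : ℕ :=
  if x u = 1 then
    if v u < drawProb w (∑ i, b i) (∑ i, a i) then b u + 1 else b u
  else
    if v u < drawProb w (b u) (a u) then b u + 1 else b u

/-- The interacting urn mechanism driven by the environment `x` and the variables `v`: the number
of black balls in each urn at each time. The pair `x n u`, `v n u` governs the draw for urn `u`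
between the times `n` and `n + 1`. -/
noncomputable def urnProcess {U : ℕ} (w : ℕ → ℝ) (x : ℕ → Fin U → ℤ) (v : ℕ → Fin U → ℝ) :
    ℕ → Fin U → ℕ
  | 0 => fun _ => 0
  | n + 1 => urnStep w (x n) (v n) (urnProcess w x v n) (fun u => n - urnProcess w x v n u)

/-- The random input of the mechanism with `U` urns and interaction parameter `p`: i.i.d. variables
`X n u` with law `p δ₁ + (1 - p) δ₋₁`, i.i.d. variables `V n u` uniform on `[0, 1]`, the family `V`
being independent of the family `X`. -/
structure IsUrnInput {U : ℕ} {Ω : Type*} [MeasurableSpace Ω] (P : Measure Ω) (p : ℝ)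
    (X : ℕ → Fin U → Ω → ℤ) (V : ℕ → Fin U → Ω → ℝ) : Prop where
  measurable_X : ∀ n u, Measurable (X n u)
  measurable_V : ∀ n u, Measurable (V n u)
  law_X : ∀ n u, P.map (X n u) =
    ENNReal.ofReal p • Measure.dirac (1 : ℤ) + ENNReal.ofReal (1 - p) • Measure.dirac (-1 : ℤ)
  law_V : ∀ n u, P.map (V n u) = (volume : Measure ℝ).restrict (Set.Icc 0 1)
  indep_X : iIndepFun (fun (i : ℕ × Fin U) (ω : Ω) => X i.1 i.2 ω) P
  indep_V : iIndepFun (fun (i : ℕ × Fin U) (ω : Ω) => V i.1 i.2 ω) P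
  indep_X_V : IndepFun (fun (ω : Ω) (i : ℕ × Fin U) => X i.1 i.2 ω)
    (fun (ω : Ω) (i : ℕ × Fin U) => V i.1 i.2 ω) P

theorem IsUrnPath.le {U : ℕ} {r : ℕ → Fin U → ℕ} (h : IsUrnPath r) (n : ℕ) (u : Fin U) :
    r n u ≤ n := by
  induction n with
  | zero => exact (h.zero u).le
  | succ n ih => rcases h.step n u with h' | h' <;> omega

theorem isUrnPath_urnProcess {U : ℕ} (w : ℕ → ℝ) (x : ℕ → Fin U → ℤ) (v : ℕ → Fin U → ℝ) :
    IsUrnPath (urnProcess w x v) := by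
  refine ⟨fun _ => rfl, fun n u => ?_⟩
  simp only [urnProcess, urnStep]
  split_ifs <;> simp

/-- The recursion of the mechanism in terms of the numbers of balls of its urn path. -/
theorem urnProcess_succ {U : ℕ} (w : ℕ → ℝ) (x : ℕ → Fin U → ℤ) (v : ℕ → Fin U → ℝ)
    (n : ℕ) (u : Fin U) :
    urnProcess w x v (n + 1) u =
      if x n u = 1 then
        if v n u < drawProb w (totalBlack (urnProcess w x v) n) (totalWhite (urnProcess w x v) n)
        then urnProcess w x v n u + 1 else urnProcess w x v n u
      else
        if v n u < drawProb w (urnProcess w x v n u) (whiteCount (urnProcess w x v) n u)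
        then urnProcess w x v n u + 1 else urnProcess w x v n u := rfl

end InteractingUrns

/-! With exponential weights the chance of black depends only on the difference of the two counts,
so the mechanism becomes a system of `U` walks with steps `±1`. Each walk is pushed upwards either
by its own value or by the sum of all values, with failure probability at most `ρ ^ (-z)` at value
`z ≥ 0`. At every time the sum of the walks or the sum of their negatives is nonnegative, so one of
the two is nonnegative infinitely often; by colour symmetry it suffices to treat the first case.

Call a time favourable if the later uniforms stay below thresholds tending geometrically to `1` and
the signs `X` never lose more than `k / (2U)` in `k` steps. This concerns the future only, and its
probability is bounded below uniformly in time (`IsDrive.exists_le_measure_favourable`). By Lévy's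
upward theorem, a past event that recurs infinitely often therefore meets a favourable time
(`ae_exists_mem_of_frequently_mem`).

At a favourable time with nonnegative sum, some walk is nonnegative. It climbs at every step, and
the others cannot lose enough to stop the sum from growing linearly, so all common draws lead
upwards forever (`IsDrivenWalk.commonUp`). From then on each walk dominates a simple symmetric
random walk, hence is nonnegative infinitely often. A second favourable time, found for each walk
separately, makes its own draws succeed forever as well (`IsDrivenWalk.eventually_up`). -/

namespace InteractingUrns

open Filter Topology

/-! ### Independence of pairs, and a conditional Borel–Cantelli type argument -/

section Independence

variable {Ω : Type*} {mΩ : MeasurableSpace Ω} {P : Measure Ω}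

/-- If `(f i)` and `(g i)` are independent families and the two families are independent of each
other, then the pairs `(f i, g i)` are independent. -/
theorem iIndepFun_prodMk {ι : Type*} {α β : ι → Type*} [∀ i, MeasurableSpace (α i)]
    [∀ i, MeasurableSpace (β i)] {f : ∀ i, Ω → α i} {g : ∀ i, Ω → β i}
    (hfm : ∀ i, Measurable (f i)) (hgm : ∀ i, Measurable (g i))
    (hf : iIndepFun f P) (hg : iIndepFun g P)
    (hfg : IndepFun (fun ω i => f i ω) (fun ω i => g i ω) P) :
    iIndepFun (fun i ω => (f i ω, g i ω)) P := by
  have key : ∀ (S : Finset ι) (A : ∀ i, Set (α i)) (B : ∀ i, Set (β i)),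
      (∀ i, MeasurableSet (A i)) → (∀ i, MeasurableSet (B i)) →
      P (⋂ i ∈ S, (f i ⁻¹' A i ∩ g i ⁻¹' B i)) =
        (∏ i ∈ S, P (f i ⁻¹' A i)) * ∏ i ∈ S, P (g i ⁻¹' B i) := by
    intro S A B hA hB
    have h1 : (⋂ i ∈ S, (f i ⁻¹' A i ∩ g i ⁻¹' B i)) =
        ((fun ω i => f i ω) ⁻¹' (⋂ i ∈ S, (fun x : ∀ i, α i => x i) ⁻¹' A i)) ∩
        ((fun ω i => g i ω) ⁻¹' (⋂ i ∈ S, (fun x : ∀ i, β i => x i) ⁻¹' B i)) := by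
      ext ω; simp only [Set.mem_iInter, Set.mem_inter_iff, Set.mem_preimage]
      exact ⟨fun h => ⟨fun i hi => (h i hi).1, fun i hi => (h i hi).2⟩,
        fun h i hi => ⟨h.1 i hi, h.2 i hi⟩⟩
    rw [h1, hfg.measure_inter_preimage_eq_mul _ _
      (Finset.measurableSet_biInter _ fun i _ => measurable_pi_apply i (hA i))
      (Finset.measurableSet_biInter _ fun i _ => measurable_pi_apply i (hB i))]
    simp only [Set.preimage_iInter, ← Set.preimage_comp]
    congr 1
    · exact hf.measure_inter_preimage_eq_mul S fun i _ => hA i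
    · exact hg.measure_inter_preimage_eq_mul S fun i _ => hB i
  -- Preimages of rectangles form a π-system generating the σ-algebra of the pair, so it is enough
  -- to factor probabilities on them. `key` does this, and its singleton case splits each single
  -- factor.
  let π : ι → Set (Set Ω) := fun i =>
    {s | ∃ A B, MeasurableSet A ∧ MeasurableSet B ∧ s = f i ⁻¹' A ∩ g i ⁻¹' B}
  refine iIndepSets.iIndep (fun i => ((hfm i).prodMk (hgm i)).comap_le) π ?_ ?_ ?_
  · rintro i _ ⟨A, B, hA, hB, rfl⟩ _ ⟨A', B', hA', hB', rfl⟩ -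
    exact ⟨A ∩ A', B ∩ B', hA.inter hA', hB.inter hB', by ext; simp; tauto⟩
  · intro i
    beta_reduce
    rw [← generateFrom_prod, MeasurableSpace.comap_generateFrom]
    congr 1
    ext s
    constructor
    · rintro ⟨_, ⟨A, hA, B, hB, rfl⟩, rfl⟩
      exact ⟨A, B, hA, hB, rfl⟩
    · rintro ⟨A, B, hA, hB, rfl⟩
      exact ⟨_, ⟨A, hA, B, hB, rfl⟩, rfl⟩
  · rw [iIndepSets_iff]
    intro S s hs
    classical
    have hs' : ∀ i, ∃ A B, MeasurableSet A ∧ MeasurableSet B ∧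
        (i ∈ S → s i = f i ⁻¹' A ∩ g i ⁻¹' B) := by
      intro i
      by_cases hi : i ∈ S
      · obtain ⟨A, B, hA, hB, h⟩ := hs i hi
        exact ⟨A, B, hA, hB, fun _ => h⟩
      · exact ⟨∅, ∅, .empty, .empty, fun h => absurd h hi⟩
    choose A B hA hB hAB using hs'
    rw [Set.iInter₂_congr hAB, key S A B hA hB, ← Finset.prod_mul_distrib]
    refine Finset.prod_congr rfl fun i hi => ?_
    rw [hAB i hi]
    simpa using (key {i} A B hA hB).symm

/-- Suppose that the events `H n` have probability at least `c > 0` and are independent of the past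
`ℱ n`. If the events `G n` of the past occur infinitely often, then almost surely some `G n` occurs
together with `H n`. -/
theorem ae_exists_mem_of_frequently_mem [IsProbabilityMeasure P] (ℱ : Filtration ℕ mΩ)
    {𝒯 : ℕ → MeasurableSpace Ω} (h𝒯 : ∀ n, 𝒯 n ≤ ⨆ n, ℱ n) (hind : ∀ n, Indep (𝒯 n) (ℱ n) P)
    {G H : ℕ → Set Ω} (hG : ∀ n, MeasurableSet[ℱ n] (G n)) (hH : ∀ n, MeasurableSet[𝒯 n] (H n))
    {c : ℝ} (hc : 0 < c) (hPH : ∀ n, c ≤ P.real (H n)) :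
    ∀ᵐ ω ∂P, (∃ᶠ n in atTop, ω ∈ G n) → ∃ n, ω ∈ G n ∧ ω ∈ H n := by
  have hle : (⨆ n, ℱ n) ≤ mΩ := iSup_le ℱ.le
  set E : Set Ω := ⋃ n, G n ∩ H n with hE
  have hEm : MeasurableSet[⨆ n, ℱ n] E :=
    MeasurableSet.iUnion fun n => (le_iSup (fun n => (ℱ n : MeasurableSpace Ω)) n _ (hG n)).inter
      (h𝒯 n _ (hH n))
  have hEm' := hle _ hEm
  have hHm : ∀ n, MeasurableSet (H n) := fun n => hle _ (h𝒯 n _ (hH n))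
  -- Lévy's upward theorem: the conditional probabilities of `E` converge to its indicator. On `G n`
  -- they are at least `P (H n) ≥ c`, because `H n` is independent of `ℱ n`. If this happens
  -- infinitely often the limit is positive, hence `1`.
  set g : Ω → ℝ := E.indicator 1 with hg
  have hgint : Integrable g P := (integrable_const (1 : ℝ)).indicator hEm'
  have hlim := tendsto_ae_condExp (μ := P) (ℱ := ℱ) g
  have hself : P[g | ⨆ n, ℱ n] = g :=
    condExp_of_stronglyMeasurable hle (stronglyMeasurable_one.indicator hEm) hgint
  have hlow : ∀ᵐ ω ∂P, ∀ n, ω ∈ G n → c ≤ (P[g | ℱ n]) ω := by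
    rw [ae_all_iff]
    intro n
    have h1 : Integrable ((H n).indicator (1 : Ω → ℝ)) P :=
      (integrable_const (1 : ℝ)).indicator (hHm n)
    have h2 : P[(G n).indicator ((H n).indicator (1 : Ω → ℝ)) | ℱ n] ≤ᵐ[P] P[g | ℱ n] := by
      refine condExp_mono (h1.indicator (ℱ.le n _ (hG n))) hgint (ae_of_all _ fun ω => ?_)
      rw [Set.indicator_indicator]
      exact Set.indicator_le_indicator_of_subset (Set.subset_iUnion (fun n => G n ∩ H n) n)
        (fun _ => zero_le_one) ω
    have h3 := condExp_indicator (m := ℱ n) h1 (hG n)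
    have h4 : P[(H n).indicator (1 : Ω → ℝ) | ℱ n] =ᵐ[P] fun _ => _ :=
      condExp_indep_eq ((h𝒯 n).trans hle) (ℱ.le n)
      (stronglyMeasurable_one.indicator (hH n)) (hind n)
    filter_upwards [h2, h3, h4] with ω h2 h3 h4 hω
    rw [h3, Set.indicator_of_mem hω, h4, integral_indicator_one (hHm n)] at h2
    exact (hPH n).trans h2
  filter_upwards [hlim, hlow] with ω hlim hlow hfreq
  rw [hself] at hlim
  have hcg : c ≤ g ω := by
    refine ge_of_tendsto_of_frequently hlim (hfreq.mono fun n hn => hlow n hn)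
  by_contra hne
  have : ω ∉ E := by simpa [hE] using hne
  rw [hg, Set.indicator_of_notMem this] at hcg
  exact absurd hcg (not_le.2 hc)

end Independence

/-! ### Abstract input and favourable times -/

/-- The random input of a system of `U` walks: at time `n` walk `u` uses the pair
`X (n, u) ∈ {1, -1}`, `Y (n, u)`, measurable with respect to `𝒢 (n, u)`, and the `σ`-algebras
`𝒢 (n, u)` are independent. -/
structure IsDrive {U : ℕ} {Ω : Type*} [mΩ : MeasurableSpace Ω] (P : Measure Ω)
    (𝒢 : ℕ × Fin U → MeasurableSpace Ω) (X : ℕ × Fin U → Ω → ℤ) (Y : ℕ × Fin U → Ω → ℝ) :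
    Prop where
  le : ∀ i, 𝒢 i ≤ mΩ
  indep : iIndep 𝒢 P
  measurable_X : ∀ i, Measurable[𝒢 i] (X i)
  measurable_Y : ∀ i, Measurable[𝒢 i] (Y i)
  sign : ∀ i ω, X i ω = 1 ∨ X i ω = -1
  integral_X : ∀ i, ∫ ω, (X i ω : ℝ) ∂P = 0
  upper_tail : ∀ i t, 0 ≤ t → t ≤ 1 → P {ω | 1 - t ≤ Y i ω} ≤ ENNReal.ofReal t
  joint : ∀ i, P {ω | X i ω = 1 ∧ Y i ω < 1 / 2} = 4⁻¹

/-- The `σ`-algebra generated by the inputs at the times before `n`. -/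
abbrev past {U : ℕ} {Ω : Type*} (𝒢 : ℕ × Fin U → MeasurableSpace Ω) (n : ℕ) : MeasurableSpace Ω :=
  ⨆ i ∈ {i : ℕ × Fin U | i.1 < n}, 𝒢 i

/-- The `σ`-algebra generated by the inputs from time `n` on. -/
abbrev future {U : ℕ} {Ω : Type*} (𝒢 : ℕ × Fin U → MeasurableSpace Ω) (n : ℕ) : MeasurableSpace Ω :=
  ⨆ i ∈ {i : ℕ × Fin U | n ≤ i.1}, 𝒢 i

/-- From time `n` on the variables `y` stay below the thresholds `thr`, and all the partial sums
of `x` stay above a line of slope `-1 / (2U)`. -/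
def Favourable {U : ℕ} (thr : ℕ → ℝ) (x : ℕ × Fin U → ℤ) (y : ℕ × Fin U → ℝ) (n : ℕ) : Prop :=
  ∀ k u, y (n + k, u) < thr k ∧ -(k : ℤ) ≤ 2 * U * ∑ i ∈ Finset.range k, x (n + i, u)

/-! ### Pathwise behaviour after a favourable time -/

section Deterministic

/-- A system of integer walks with steps `±1` driven by `x` and `y`: walk `u` steps up when
`x = 1` and `y` is less than `σ` of the sum of all walks, and also when `x = -1` and `y` is less than
`σ` of the walk itself. -/
structure IsDrivenWalk {U : ℕ} (σ : ℤ → ℝ) (x : ℕ × Fin U → ℤ) (y : ℕ × Fin U → ℝ)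
    (d : ℕ → Fin U → ℤ) : Prop where
  step : ∀ n u, d (n + 1) u = d n u + 1 ∨ d (n + 1) u = d n u - 1
  sign : ∀ i, x i = 1 ∨ x i = -1
  common : ∀ n u, x (n, u) = 1 → y (n, u) < σ (∑ v, d n v) → d (n + 1) u = d n u + 1
  own : ∀ n u, x (n, u) = -1 → y (n, u) < σ (d n u) → d (n + 1) u = d n u + 1

/-- From time `n` on, all the draws from the sum of the walks lead upwards. -/
def CommonUp {U : ℕ} (x : ℕ × Fin U → ℤ) (d : ℕ → Fin U → ℤ) (n : ℕ) : Prop :=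
  ∀ k ≥ n, ∀ u, x (k, u) = 1 → d (k + 1) u = d k u + 1

variable {U : ℕ} {σ : ℤ → ℝ} {x : ℕ × Fin U → ℤ} {y : ℕ × Fin U → ℝ} {d : ℕ → Fin U → ℤ}
  {thr : ℕ → ℝ} {n : ℕ}

/-- Some walk `u₀` starts nonnegative. Induction on the elapsed time `k` maintains that `u₀` has
gained `k` and that every other walk has done at least as well as its partial sum of `x`, thus lost
at most `k / (2U)`. The sum is then at least `k / 2`, which is what the threshold at time `k`
requires for the next common draw. -/
theorem IsDrivenWalk.commonUp (h : IsDrivenWalk σ x y d)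
    (hσ : ∀ (k : ℕ) z, (k : ℤ) ≤ 2 * z → thr k ≤ σ z)
    (hfav : Favourable thr x y n) (h0 : 0 ≤ ∑ u, d n u) : CommonUp x d n := by
  rcases Nat.eq_zero_or_pos U with rfl | hU
  · exact fun _ _ u => u.elim0
  have : Nonempty (Fin U) := ⟨⟨0, hU⟩⟩
  obtain ⟨u₀, -, hu₀⟩ : ∃ u ∈ Finset.univ, 0 ≤ d n u := by
    refine Finset.exists_le_of_sum_le Finset.univ_nonempty (by simpa using h0)
  set R : ℕ → Fin U → ℤ := fun k u => ∑ i ∈ Finset.range k, x (n + i, u) with hR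
  have hRs : ∀ k u, R (k + 1) u = R k u + x (n + k, u) := fun k u => Finset.sum_range_succ _ _
  have hsum : ∀ k : ℕ, (∀ u, d n u + R k u ≤ d (n + k) u) → d n u₀ + k ≤ d (n + k) u₀ →
      (k : ℤ) ≤ 2 * ∑ u, d (n + k) u := by
    intro k h1 h2
    have h3 : ∀ u, -(k : ℤ) ≤ 2 * U * R k u := fun u => (hfav k u).2
    -- Everything is scaled by `2U`: walk `u₀` contributes `2U * k = (2U + 1) * k - k` and any other
    -- walk at least `-k`. In total the sum grows by at least `(U + 1) * k / (2U)`.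
    have h4 : ∑ u, (if u = u₀ then ((2 * U + 1) * k : ℤ) else 0) + ∑ u : Fin U, -(k : ℤ) ≤
        ∑ u, 2 * U * (d (n + k) u - d n u) := by
      rw [← Finset.sum_add_distrib]
      refine Finset.sum_le_sum fun u _ => ?_
      split_ifs with hu
      · subst hu
        nlinarith
      · have := h1 u
        have := h3 u
        nlinarith
    rw [← Finset.mul_sum, Finset.sum_sub_distrib] at h4
    simp only [Finset.sum_ite_eq', Finset.mem_univ, if_true, Finset.sum_const, Finset.card_univ,
      Fintype.card_fin, nsmul_eq_mul] at h4
    have hU' : (1 : ℤ) ≤ U := by exact_mod_cast hU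
    by_contra hlt
    push Not at hlt
    nlinarith [mul_pos (show (0 : ℤ) < U by omega)
      (show (0 : ℤ) < k - 2 * ∑ u, d (n + k) u by omega),
      mul_nonneg (show (0 : ℤ) ≤ U by omega) h0]
  have hup : ∀ k : ℕ, (k : ℤ) ≤ 2 * ∑ u, d (n + k) u → ∀ u, x (n + k, u) = 1 →
      d (n + k + 1) u = d (n + k) u + 1 := fun k hk u hx =>
    h.common _ _ hx ((hfav k u).1.trans_le (hσ k _ hk))
  have main : ∀ k : ℕ, (∀ u, d n u + R k u ≤ d (n + k) u) ∧ d n u₀ + k ≤ d (n + k) u₀ := by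
    intro k
    induction k with
    | zero => simp [hR]
    | succ k ih =>
      have hk := hsum k ih.1 ih.2
      rw [← add_assoc]
      refine ⟨fun u => ?_, ?_⟩
      · have := ih.1 u
        rw [hRs]
        rcases h.sign (n + k, u) with hx | hx
        · rw [hup k hk u hx]; omega
        · rcases h.step (n + k) u with hs | hs <;> omega
      · have : d (n + k + 1) u₀ = d (n + k) u₀ + 1 := by
          rcases h.sign (n + k, u₀) with hx | hx
          · exact hup k hk _ hx
          · exact h.own _ _ hx ((hfav k u₀).1.trans_le (hσ k _ (by omega)))
        push_cast
        omega
  intro k hk u hx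
  obtain ⟨j, rfl⟩ := Nat.exists_eq_add_of_le hk
  exact hup j (hsum j (main j).1 (main j).2) u hx

/-- Common draws already lead upwards, so only own draws matter. As long as the walk has never
stepped down it is at least `k` after `k` steps, which is more than the threshold needs. -/
theorem IsDrivenWalk.eventually_up (h : IsDrivenWalk σ x y d)
    (hσ : ∀ (k : ℕ) z, (k : ℤ) ≤ 2 * z → thr k ≤ σ z) (hfav : Favourable thr x y n)
    (hc : CommonUp x d n) {u : Fin U} (h0 : 0 ≤ d n u) (k : ℕ) (hk : n ≤ k) :
    d (k + 1) u = d k u + 1 := by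
  have hstep : ∀ k : ℕ, k ≤ d (n + k) u → d (n + k + 1) u = d (n + k) u + 1 := by
    intro k hk
    rcases h.sign (n + k, u) with hx | hx
    · exact hc _ (by omega) _ hx
    · exact h.own _ _ hx ((hfav k u).1.trans_le (hσ k _ (by omega)))
  have hlow : ∀ k : ℕ, k ≤ d (n + k) u := by
    intro k
    induction k with
    | zero => simpa using h0
    | succ k ih => rw [← add_assoc, hstep k ih]; push_cast; omega
  obtain ⟨j, rfl⟩ := Nat.exists_eq_add_of_le hk
  exact hstep j (hlow j)

/-- If all common draws lead upwards, a walk dominates the partial sums of `x`. -/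
theorem IsDrivenWalk.sum_le (h : IsDrivenWalk σ x y d) (hc : CommonUp x d n) (u : Fin U) (m : ℕ)
    (hm : n ≤ m) :
    d n u + ∑ i ∈ Finset.range m, x (i, u) - ∑ i ∈ Finset.range n, x (i, u) ≤ d m u := by
  induction m, hm using Nat.le_induction with
  | base => omega
  | succ m hm ih =>
    rw [Finset.sum_range_succ]
    rcases h.sign (m, u) with hx | hx
    · have := hc m hm u hx
      omega
    · rcases h.step m u with hs | hs <;> omega

end Deterministic

/-! ### Probability of favourable times and almost sure ascent -/

section Probability

variable {U : ℕ} {Ω : Type*} {mΩ : MeasurableSpace Ω} {P : Measure Ω}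
  {𝒢 : ℕ × Fin U → MeasurableSpace Ω} {X : ℕ × Fin U → Ω → ℤ} {Y : ℕ × Fin U → Ω → ℝ}

theorem le_past {i : ℕ × Fin U} {n : ℕ} (hi : i.1 < n) : 𝒢 i ≤ past 𝒢 n :=
  le_iSup₂_of_le i hi le_rfl

theorem le_future {i : ℕ × Fin U} {n : ℕ} (hi : n ≤ i.1) : 𝒢 i ≤ future 𝒢 n :=
  le_iSup₂_of_le i hi le_rfl

theorem past_mono : Monotone (past 𝒢) := fun _ _ hmn =>
  iSup₂_le fun _ hi => le_past (lt_of_lt_of_le hi hmn)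

theorem future_le_iSup_past (n : ℕ) : future 𝒢 n ≤ ⨆ n, past 𝒢 n :=
  iSup₂_le fun i _ => le_iSup_of_le (i.1 + 1) (le_past (Nat.lt_succ_self _))

/-- The filtration of the inputs before the times `n`. -/
def pastFiltration (h𝒢 : ∀ i, 𝒢 i ≤ mΩ) : Filtration ℕ mΩ where
  seq := past 𝒢
  mono' := past_mono
  le' _ := iSup₂_le fun i _ => h𝒢 i

theorem IsDrive.indep_future_past (h : IsDrive P 𝒢 X Y) (n : ℕ) :
    Indep (future 𝒢 n) (past 𝒢 n) P := by
  refine indep_iSup_of_disjoint h.le h.indep (Set.disjoint_left.2 fun i hi hi' => ?_)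
  exact (not_lt.2 hi : ¬ i.1 < n) hi'

theorem IsDrive.measurable_X_future (h : IsDrive P 𝒢 X Y) {i : ℕ × Fin U} {n : ℕ} (hi : n ≤ i.1) :
    Measurable[future 𝒢 n] (X i) := (h.measurable_X i).mono (le_future hi) le_rfl

theorem IsDrive.measurable_Y_future (h : IsDrive P 𝒢 X Y) {i : ℕ × Fin U} {n : ℕ} (hi : n ≤ i.1) :
    Measurable[future 𝒢 n] (Y i) := (h.measurable_Y i).mono (le_future hi) le_rfl

/-- Measurability of the event that from time `n` on the variables `Y` stay below the thresholds `t`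
and the partial sums of `X` stay above a line of slope `-1 / (2U)`. -/
theorem IsDrive.measurableSet_bounds (h : IsDrive P 𝒢 X Y) (t : ℕ → ℝ) (a : ℤ) (n : ℕ) :
    MeasurableSet[future 𝒢 n] {ω | ∀ k u, Y (n + k, u) ω < t k ∧
      -(k : ℤ) ≤ 2 * U * (a + ∑ i ∈ Finset.range k, X (n + i, u) ω)} := by
  simp only [Set.ofPred_forall]
  refine MeasurableSet.iInter fun k => MeasurableSet.iInter fun u => ?_
  refine MeasurableSet.inter ?_ ?_
  · exact h.measurable_Y_future (i := (n + k, u)) (Nat.le_add_right _ _) measurableSet_Iio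
  · have hs : Measurable[future 𝒢 n] fun ω => ∑ i ∈ Finset.range k, X (n + i, u) ω :=
      Finset.measurable_sum _ fun i _ =>
        h.measurable_X_future (i := (n + i, u)) (Nat.le_add_right _ _)
    exact hs (MeasurableSet.of_discrete (s := {z : ℤ | -(k : ℤ) ≤ 2 * U * (a + z)}))

theorem IsDrive.measurableSet_favourable (h : IsDrive P 𝒢 X Y) (thr : ℕ → ℝ) (n : ℕ) :
    MeasurableSet[future 𝒢 n]
      {ω | Favourable thr (fun i => X i ω) (fun i => Y i ω) n} := by
  simpa [Favourable] using h.measurableSet_bounds thr 0 n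

theorem IsDrive.iIndepFun_X (h : IsDrive P 𝒢 X Y) :
    iIndepFun (fun i ω => (X i ω : ℝ)) P := by
  have h1 : iIndepFun X P :=
    iIndep_of_iIndep_of_le h.indep fun i => (h.measurable_X i).comap_le
  exact h1.comp (fun _ z => (z : ℝ)) fun _ => measurable_from_top

theorem IsDrive.integrable_X [IsProbabilityMeasure P] (h : IsDrive P 𝒢 X Y) (i : ℕ × Fin U) :
    Integrable (fun ω => (X i ω : ℝ)) P := by
  refine Integrable.of_bound (C := 1)
    ((measurable_from_top (f := fun z : ℤ => (z : ℝ))).comp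
      ((h.measurable_X i).mono (h.le i) le_rfl)).aestronglyMeasurable (ae_of_all _ fun ω => ?_)
  rcases h.sign i ω with hx | hx <;> simp [hx]

/-- Exponential bound for the probability that a partial sum of `X` falls below a line of
slope `-1 / (2U)`. -/
theorem IsDrive.measure_sum_lt_le [IsProbabilityMeasure P] (h : IsDrive P 𝒢 X Y) (u : Fin U)
    (n K j : ℕ) :
    P {ω | 2 * (U : ℤ) * (K + ∑ i ∈ Finset.range j, X (n + i, u) ω) < -(j : ℤ)} ≤
      ENNReal.ofReal (Real.exp (-(1 / (8 * (U : ℝ) ^ 2))) ^ (K + j)) := by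
  have hU : (1 : ℝ) ≤ U := by exact_mod_cast Nat.one_le_of_lt u.2
  rcases Nat.eq_zero_or_pos j with rfl | hj
  · have : {ω : Ω | 2 * (U : ℤ) * (K + ∑ i ∈ Finset.range 0, X (n + i, u) ω) < -((0 : ℕ) : ℤ)} =
        ∅ := by
      ext ω
      simp only [Finset.range_zero, Finset.sum_empty, Set.mem_ofPred_eq, Set.mem_empty_iff_false,
        iff_false, not_lt]
      simp; positivity
    rw [this]
    simp
  have hj' : (0 : ℝ) < j := by exact_mod_cast hj
  have hind : iIndepFun (fun (i : ℕ) ω => -(X (n + i, u) ω : ℝ)) P :=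
    ((h.iIndepFun_X).precomp (g := fun i : ℕ => (n + i, u))
      (fun a b hab => by simpa using hab)).comp
      (fun _ z => -z) fun _ => measurable_neg
  -- Hoeffding's lemma on `[-1, 1]` gives variance proxy `((1 - (-1)) / 2) ^ 2 = 1`.
  have hsub : ∀ i < j, HasSubgaussianMGF (fun ω => -(X (n + i, u) ω : ℝ)) 1 P := by
    intro i _
    have := hasSubgaussianMGF_of_mem_Icc_of_integral_eq_zero (μ := P) (a := -1) (b := 1)
      (X := fun ω => -(X (n + i, u) ω : ℝ)) (h.integrable_X (n + i, u)).neg.aemeasurable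
      (ae_of_all _ fun ω => by rcases h.sign (n + i, u) ω with hx | hx <;> simp [hx])
      (by rw [integral_neg, h.integral_X, neg_zero])
    convert this using 1
    norm_num
  have hmain := HasSubgaussianMGF.measure_sum_range_ge_le_of_iIndepFun hind hsub
    (ε := K + j / (2 * U)) (by positivity)
  have hmono : P.real {ω | 2 * (U : ℤ) * (K + ∑ i ∈ Finset.range j, X (n + i, u) ω) < -(j : ℤ)} ≤
      Real.exp (-(1 / (8 * (U : ℝ) ^ 2))) ^ (K + j) := by
    refine (measureReal_mono fun ω hω => ?_).trans (hmain.trans ?_)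
    · have hω' : 2 * (U : ℝ) * (K + ∑ i ∈ Finset.range j, (X (n + i, u) ω : ℝ)) < -(j : ℝ) := by
        exact_mod_cast hω
      simp only [Set.mem_ofPred_eq, Finset.sum_neg_distrib]
      have h2 : (j : ℝ) / (2 * U) * (2 * U) = j := div_mul_cancel₀ _ (by positivity)
      by_contra hlt
      push Not at hlt
      nlinarith
    -- With `a = 1 / (2U) ≤ 1`, the Hoeffding exponent `(K + j * a) ^ 2 / (2 * j)` is at least `(K +
    -- j) * a ^ 2 / 2`, since `2 * a ≥ a ^ 2`.
    · rw [← Real.exp_nat_mul, Real.exp_le_exp]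
      have hx : (0 : ℝ) < 1 / (2 * U) := by positivity
      have hx1 : 1 / (2 * (U : ℝ)) ≤ 1 := by
        rw [div_le_one (by positivity)]; linarith
      have e1 : 1 / (8 * (U : ℝ) ^ 2) = (1 / (2 * U)) ^ 2 / 2 := by field_simp; norm_num
      have e2 : (j : ℝ) / (2 * U) = j * (1 / (2 * U)) := by ring
      rw [e1, e2]
      generalize 1 / (2 * (U : ℝ)) = a at hx hx1
      rw [neg_div, mul_neg, neg_le_neg_iff, le_div_iff₀ (by simpa using hj)]
      push_cast
      nlinarith [mul_nonneg (mul_nonneg hj'.le (Nat.cast_nonneg (α := ℝ) K)) (mul_nonneg hx.le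
        (sub_nonneg.2 hx1)), mul_nonneg (mul_nonneg hj'.le (Nat.cast_nonneg (α := ℝ) K)) hx.le,
        sq_nonneg (K : ℝ)]
  rw [← ofReal_measureReal]
  exact ENNReal.ofReal_le_ofReal hmono

/-- All inputs of the `K` times from `n` on ask for a common draw with `Y < 1 / 2`. -/
def initialBlock (X : ℕ × Fin U → Ω → ℤ) (Y : ℕ × Fin U → Ω → ℝ) (n K : ℕ) : Set Ω :=
  ⋂ i ∈ Finset.Ico n (n + K) ×ˢ (Finset.univ : Finset (Fin U)), {ω | X i ω = 1 ∧ Y i ω < 1 / 2}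

theorem IsDrive.measurableSet_joint (h : IsDrive P 𝒢 X Y) (i : ℕ × Fin U) :
    MeasurableSet[𝒢 i] {ω | X i ω = 1 ∧ Y i ω < 1 / 2} :=
  ((h.measurable_X i) (measurableSet_singleton 1)).inter ((h.measurable_Y i) measurableSet_Iio)

theorem IsDrive.measure_initialBlock (h : IsDrive P 𝒢 X Y) (n K : ℕ) :
    P (initialBlock X Y n K) = 4⁻¹ ^ (K * U) := by
  rw [initialBlock, h.indep.meas_biInter fun i _ => h.measurableSet_joint i]
  simp_rw [h.joint]
  simp

theorem IsDrive.measurableSet_initialBlock (h : IsDrive P 𝒢 X Y) (n K : ℕ) :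
    MeasurableSet[past 𝒢 (n + K)] (initialBlock X Y n K) := by
  refine Finset.measurableSet_biInter _ fun i hi => ?_
  refine le_past ?_ _ (h.measurableSet_joint i)
  simp only [Finset.mem_product, Finset.mem_Ico] at hi
  exact hi.1.2

/-- The favourable event has a probability that is bounded away from zero uniformly in time. -/
theorem IsDrive.exists_le_measure_favourable [IsProbabilityMeasure P] (h : IsDrive P 𝒢 X Y)
    {r : ℝ} (hr0 : 0 ≤ r) (hr1 : r < 1) :
    ∃ c > 0, ∀ n, c ≤ P.real
      {ω | Favourable (fun k => max (1 / 2) (1 - r ^ k)) (fun i => X i ω) (fun i => Y i ω) n} := by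
  rcases Nat.eq_zero_or_pos U with rfl | hU
  · exact ⟨1, one_pos, fun n => by simp [Favourable]⟩
  set q : ℝ := Real.exp (-(1 / (8 * (U : ℝ) ^ 2))) with hq
  have hU' : (0 : ℝ) < U := by exact_mod_cast hU
  have hq0 : 0 ≤ q := (Real.exp_pos _).le
  have hq1 : q < 1 := Real.exp_lt_one_iff.2 (neg_lt_zero.2 (by positivity))
  set b : ℕ → ℝ := fun k => U * (r ^ k + q ^ k) with hb
  have hbs : Summable b := ((summable_geometric_of_lt_one hr0 hr1).add
    (summable_geometric_of_lt_one hq0 hq1)).mul_left _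
  have hb0 : ∀ k, 0 ≤ b k := fun k => by positivity
  -- `b k` bounds the probability that one of the `U` walks violates its bounds. `K` is chosen to
  -- make the tail of this convergent series less than `1 / 2`.
  obtain ⟨K, hK⟩ := ((tendsto_order.1 (tendsto_sum_nat_add b)).2 (1 / 2) (by norm_num)).exists
  refine ⟨(1 / 4) ^ (K * U) * (1 / 2), by positivity, fun n => ?_⟩
  -- The first `K` times are forced by `initialBlock`, at the cost of a factor `(1 / 4) ^ (K * U)`;
  -- they give the partial sums a head start `K`. `T` controls the times from `n + K` on and is
  -- independent of that block. The floor `1 / 2` in the thresholds is what lets the block meet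
  -- them, as `1 - r ^ k` vanishes at `k = 0`.
  set T : Set Ω := {ω | ∀ k u, Y (n + K + k, u) ω < 1 - r ^ (k + K) ∧
      -(k : ℤ) ≤ 2 * U * ((K : ℤ) + ∑ i ∈ Finset.range k, X (n + K + i, u) ω)} with hT
  have hTf : MeasurableSet[future 𝒢 (n + K)] T :=
    h.measurableSet_bounds (fun k => 1 - r ^ (k + K)) K (n + K)
  have hTm : MeasurableSet T := iSup₂_le (fun i _ => h.le i) _ hTf
  have hTc : P Tᶜ ≤ ENNReal.ofReal (1 / 2) := by
    have hsub : Tᶜ ⊆ ⋃ k, ⋃ u, ({ω | 1 - r ^ (k + K) ≤ Y (n + K + k, u) ω} ∪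
        {ω | 2 * (U : ℤ) * (K + ∑ i ∈ Finset.range k, X (n + K + i, u) ω) < -(k : ℤ)}) := by
      intro ω hω
      simp only [hT, Set.mem_compl_iff, Set.mem_ofPred_eq, not_forall, not_and_or, not_lt,
        not_le] at hω
      simpa using hω
    calc P Tᶜ
      _ ≤ ∑' k, ∑ u : Fin U, (ENNReal.ofReal (r ^ (k + K)) + ENNReal.ofReal (q ^ (k + K))) := by
          refine (measure_mono hsub).trans ((measure_iUnion_le _).trans ?_)
          refine ENNReal.tsum_le_tsum fun k => (measure_iUnion_fintype_le _ _).trans ?_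
          refine Finset.sum_le_sum fun u _ => (measure_union_le _ _).trans (add_le_add ?_ ?_)
          · exact h.upper_tail _ _ (by positivity) (pow_le_one₀ hr0 hr1.le)
          · rw [add_comm k K]
            exact h.measure_sum_lt_le u (n + K) K k
      _ = ∑' k, ENNReal.ofReal (b (k + K)) := by
          refine tsum_congr fun k => ?_
          rw [← ENNReal.ofReal_add (by positivity) (by positivity), Finset.sum_const,
            Finset.card_univ, Fintype.card_fin, nsmul_eq_mul, hb, ENNReal.ofReal_mul hU'.le,
            ENNReal.ofReal_natCast]
      _ = ENNReal.ofReal (∑' k, b (k + K)) :=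
          (ENNReal.ofReal_tsum_of_nonneg (fun k => hb0 _) ((summable_nat_add_iff K).2 hbs)).symm
      _ ≤ ENNReal.ofReal (1 / 2) := ENNReal.ofReal_le_ofReal hK.le
  have hTr : 1 / 2 ≤ P.real T := by
    have h1 : P.real Tᶜ ≤ 1 / 2 := ENNReal.toReal_le_of_le_ofReal (by norm_num) hTc
    rw [probReal_compl_eq_one_sub hTm] at h1
    linarith
  have hBT : P.real (T ∩ initialBlock X Y n K) = P.real T * (1 / 4) ^ (K * U) := by
    have h1 := (Indep_iff _ _ _).1 (h.indep_future_past (n + K)) _ _ hTf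
      (h.measurableSet_initialBlock n K)
    rw [measureReal_def, h1, ENNReal.toReal_mul, h.measure_initialBlock]
    simp [measureReal_def]
  have hsub : T ∩ initialBlock X Y n K ⊆
      {ω | Favourable (fun k => max (1 / 2) (1 - r ^ k)) (fun i => X i ω) (fun i => Y i ω) n} := by
    rintro ω ⟨hωT, hωB⟩
    have hB : ∀ i < K, ∀ u, X (n + i, u) ω = 1 ∧ Y (n + i, u) ω < 1 / 2 := fun i hi u => by
      have := Set.mem_iInter₂.1 hωB (n + i, u) (by simp [hi])
      exact this
    have hBsum : ∀ k ≤ K, ∀ u, ∑ i ∈ Finset.range k, X (n + i, u) ω = k := by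
      intro k hk u
      rw [Finset.sum_congr rfl fun i hi => (hB i ((Finset.mem_range.1 hi).trans_le hk) u).1]
      simp
    intro k u
    rcases lt_or_ge k K with hk | hk
    · refine ⟨lt_max_of_lt_left (hB k hk u).2, ?_⟩
      have : (0 : ℤ) ≤ 2 * U * k := by positivity
      simp only [hBsum k hk.le u]
      omega
    · obtain ⟨j, rfl⟩ := Nat.exists_eq_add_of_le hk
      have h1 := hωT j u
      refine ⟨lt_max_of_lt_right ?_, ?_⟩
      · rw [← add_assoc, add_comm K j]
        exact h1.1
      · simp only [Finset.sum_range_add, hBsum K le_rfl u, ← add_assoc]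
        have := h1.2
        push_cast
        omega
  calc (1 / 4 : ℝ) ^ (K * U) * (1 / 2) ≤ P.real T * (1 / 4) ^ (K * U) := by
        rw [mul_comm]; gcongr
    _ = _ := hBT.symm
    _ ≤ _ := measureReal_mono hsub

theorem IsDrive.martingale_sum [IsProbabilityMeasure P] (h : IsDrive P 𝒢 X Y) (u : Fin U) :
    Martingale (fun n ω => ∑ i ∈ Finset.range n, (X (i, u) ω : ℝ)) (pastFiltration h.le) P := by
  have hX : ∀ i, Measurable[𝒢 i] fun ω => (X i ω : ℝ) := fun i =>
    (measurable_from_top (f := fun z : ℤ => (z : ℝ))).comp (h.measurable_X i)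
  refine martingale_of_condExp_sub_eq_zero_nat (fun n => ?_)
    (fun n => integrable_finsetSum _ fun i _ => h.integrable_X (i, u)) fun n => ?_
  · refine Measurable.stronglyMeasurable (Finset.measurable_sum _ fun i hi => ?_)
    exact (hX (i, u)).mono (le_past (by simpa using hi)) le_rfl
  · have h1 : (fun ω => ∑ i ∈ Finset.range (n + 1), (X (i, u) ω : ℝ)) -
        (fun ω => ∑ i ∈ Finset.range n, (X (i, u) ω : ℝ)) = fun ω => (X (n, u) ω : ℝ) := by
      ext ω
      simp [Finset.sum_range_succ]
    rw [h1]
    have h2 : P[fun ω => (X (n, u) ω : ℝ) | pastFiltration h.le n] =ᵐ[P] fun _ => _ :=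
      condExp_indep_eq (iSup₂_le fun i _ => h.le i) ((pastFiltration h.le).le n)
        ((hX (n, u)).mono (le_future le_rfl) le_rfl).stronglyMeasurable (h.indep_future_past n)
    filter_upwards [h2] with ω h2
    rw [h2, h.integral_X]
    rfl

/-- The partial sums of independent signs are almost surely unbounded above. -/
theorem IsDrive.ae_frequently_le_sum [IsProbabilityMeasure P] (h : IsDrive P 𝒢 X Y) (u : Fin U) :
    ∀ᵐ ω ∂P, ∀ M : ℤ, ∃ᶠ n in atTop, M ≤ ∑ i ∈ Finset.range n, X (i, u) ω := by
  have habs : ∀ i ω, |(X i ω : ℝ)| = 1 := fun i ω => by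
    rcases h.sign i ω with hx | hx <;> simp [hx]
  -- For a martingale with bounded increments, being bounded above is almost surely equivalent to
  -- convergence. Increments of absolute value `1` exclude convergence.
  filter_upwards [(h.martingale_sum u).submartingale.bddAbove_iff_exists_tendsto (R := 1)
    (ae_of_all _ fun ω i => by simp [Finset.sum_range_succ, habs])] with ω hω M
  have hunb : ¬ BddAbove (Set.range fun n => ∑ i ∈ Finset.range n, (X (i, u) ω : ℝ)) := by
    rw [hω]
    rintro ⟨c, hc⟩
    have h1 := ((hc.comp (tendsto_add_atTop_nat 1)).sub hc).abs
    simp only [Function.comp_def, Finset.sum_range_succ, add_sub_cancel_left, habs, sub_self,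
      abs_zero] at h1
    exact one_ne_zero (tendsto_nhds_unique tendsto_const_nhds h1)
  rw [frequently_atTop]
  intro N
  by_contra! hcon
  -- Up to time `N` a partial sum is at most `N`, and from then on it would stay below `M`.
  refine hunb ⟨max (M : ℝ) N, ?_⟩
  rintro _ ⟨n, rfl⟩
  rcases le_total N n with hn | hn
  · refine le_max_of_le_left ?_
    have := (hcon n hn).le
    beta_reduce
    exact_mod_cast this
  · refine le_max_of_le_right ?_
    calc ∑ i ∈ Finset.range n, (X (i, u) ω : ℝ) ≤ ∑ i ∈ Finset.range n, (1 : ℝ) :=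
          Finset.sum_le_sum fun i _ => (le_abs_self _).trans (habs _ _).le
      _ ≤ N := by simpa using hn

/-- If the sum of all walks is infinitely often nonnegative, then almost surely all walks
eventually only step upwards. -/
theorem IsDrive.ae_eventually_up [IsProbabilityMeasure P] (h : IsDrive P 𝒢 X Y) {σ : ℤ → ℝ} {r : ℝ}
    (hr0 : 0 ≤ r) (hr1 : r < 1) (hσ2 : ∀ z, 0 ≤ z → 1 / 2 ≤ σ z)
    (hσr : ∀ (k : ℕ) z, (k : ℤ) ≤ 2 * z → 1 - r ^ k ≤ σ z) {D : ℕ → Fin U → Ω → ℤ}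
    (hDm : ∀ n u, Measurable[past 𝒢 n] (D n u))
    (hD : ∀ ω, IsDrivenWalk σ (fun i => X i ω) (fun i => Y i ω) (fun n u => D n u ω)) :
    ∀ᵐ ω ∂P, (∃ᶠ n in atTop, 0 ≤ ∑ u, D n u ω) →
      ∃ m, ∀ n ≥ m, ∀ u, D (n + 1) u ω = D n u ω + 1 := by
  set thr : ℕ → ℝ := fun k => max (1 / 2) (1 - r ^ k)
  have hthr : ∀ (k : ℕ) z, (k : ℤ) ≤ 2 * z → thr k ≤ σ z := fun k z hk =>
    max_le (hσ2 z (by omega)) (hσr k z hk)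
  obtain ⟨c, hc, hfav⟩ := h.exists_le_measure_favourable hr0 hr1
  have hit : ∀ G : ℕ → Set Ω, (∀ n, MeasurableSet[past 𝒢 n] (G n)) →
      ∀ᵐ ω ∂P, (∃ᶠ n in atTop, ω ∈ G n) →
        ∃ n, ω ∈ G n ∧ Favourable thr (fun i => X i ω) (fun i => Y i ω) n := fun G hG =>
    ae_exists_mem_of_frequently_mem (pastFiltration h.le) future_le_iSup_past h.indep_future_past hG
      (h.measurableSet_favourable thr) hc hfav
  have hcommon := hit (fun n => {ω | 0 ≤ ∑ u, D n u ω}) fun n =>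
    (Finset.measurable_sum _ fun u _ => hDm n u) measurableSet_Ici
  -- The time after which common draws lead upwards is random, so the almost sure statement is
  -- prepared for all of the countably many `m`.
  have hown : ∀ᵐ ω ∂P, ∀ m u, (∃ᶠ n in atTop, m ≤ n ∧ 0 ≤ D n u ω) →
      ∃ n, (m ≤ n ∧ 0 ≤ D n u ω) ∧ Favourable thr (fun i => X i ω) (fun i => Y i ω) n := by
    simp only [ae_all_iff]
    intro m u
    refine hit (fun n => {ω | m ≤ n ∧ 0 ≤ D n u ω}) fun n => ?_
    exact (MeasurableSet.const _).inter (hDm n u measurableSet_Ici)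
  filter_upwards [hcommon, hown, ae_all_iff.2 h.ae_frequently_le_sum] with ω hcommon hown hsum hfreq
  obtain ⟨m, hm0, hmfav⟩ := hcommon hfreq
  have hcu := (hD ω).commonUp hthr hmfav hm0
  have hex : ∀ u, ∃ n, ∀ k ≥ n, D (k + 1) u ω = D k u ω + 1 := by
    intro u
    have hio : ∃ᶠ n in atTop, m ≤ n ∧ 0 ≤ D n u ω := by
      -- This level is what the partial sums must reach for the comparison `IsDrivenWalk.sum_le` to
      -- give `0 ≤ D n u ω`.
      refine ((hsum u (∑ i ∈ Finset.range m, X (i, u) ω - D m u ω)).and_eventually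
        (eventually_ge_atTop m)).mono fun n hn => ⟨hn.2, ?_⟩
      have := (hD ω).sum_le hcu u n hn.2
      have := hn.1
      omega
    obtain ⟨n, ⟨hmn, hn0⟩, hnfav⟩ := hown m u hio
    exact ⟨n, (hD ω).eventually_up hthr hnfav (fun k hk => hcu k (hmn.trans hk)) hn0⟩
  choose N hN using hex
  exact ⟨Finset.univ.sup N, fun n hn u => hN u n ((Finset.le_sup (Finset.mem_univ u)).trans hn)⟩

end Probability

/-! ### The exponential draw probability -/

/-- The probability of drawing black under exponential weights, as a function of the difference of
the numbers of black and white balls. -/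
noncomputable def expDraw (ρ : ℝ) (z : ℤ) : ℝ := 1 / (1 + ρ ^ (-z))

section ExpDraw

variable {ρ : ℝ}

theorem drawProb_pow (hρ : 1 < ρ) (i j : ℕ) :
    drawProb (fun n => ρ ^ n) i j = expDraw ρ ((i : ℤ) - j) := by
  have h0 : 0 < ρ := one_pos.trans hρ
  rw [drawProb, expDraw, neg_sub, zpow_sub₀ h0.ne', zpow_natCast, zpow_natCast]
  field_simp

theorem expDraw_neg (hρ : 1 < ρ) (z : ℤ) : expDraw ρ (-z) = 1 - expDraw ρ z := by
  have h0 : 0 < ρ ^ z := zpow_pos (one_pos.trans hρ) z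
  rw [expDraw, expDraw, neg_neg, zpow_neg]
  field_simp
  ring

theorem half_le_expDraw (hρ : 1 < ρ) (z : ℤ) (hz : 0 ≤ z) : 1 / 2 ≤ expDraw ρ z := by
  have h0 : 0 < ρ ^ (-z) := zpow_pos (one_pos.trans hρ) _
  have h1 : ρ ^ (-z) ≤ 1 := zpow_le_one_of_nonpos₀ hρ.le (by omega)
  exact one_div_le_one_div_of_le (by positivity) (by linarith)

/-- Uses `1 / (1 + t) ≥ 1 - t` with `t = ρ ^ (-z) ≤ ρ ^ (-k / 2)`. The square root appears because
the sum of the walks is only known to grow at rate `1 / 2`. -/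
theorem one_sub_pow_le_expDraw (hρ : 1 < ρ) (k : ℕ) (z : ℤ) (hk : (k : ℤ) ≤ 2 * z) :
    1 - (√ρ)⁻¹ ^ k ≤ expDraw ρ z := by
  have h0 : 0 < ρ ^ (-z) := zpow_pos (one_pos.trans hρ) _
  obtain ⟨m, rfl⟩ := Int.eq_ofNat_of_zero_le (show 0 ≤ z by omega)
  have hs : 1 ≤ √ρ := Real.one_le_sqrt.2 hρ.le
  have h1 : ρ ^ (-(m : ℤ)) ≤ (√ρ)⁻¹ ^ k := by
    calc ρ ^ (-(m : ℤ)) = (√ρ)⁻¹ ^ (2 * m) := by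
          rw [pow_mul, inv_pow, Real.sq_sqrt (one_pos.trans hρ).le, zpow_neg, zpow_natCast, inv_pow]
      _ ≤ _ := pow_le_pow_of_le_one (by positivity) (inv_le_one_of_one_le₀ hs) (by omega)
  rw [expDraw, le_div_iff₀ (by positivity)]
  nlinarith

end ExpDraw

/-! ### The urn input as an abstract drive -/

section Input

variable {U : ℕ} {Ω : Type*} {X : ℕ → Fin U → Ω → ℤ} {V : ℕ → Fin U → Ω → ℝ}

/-- The `σ`-algebra generated by the input of urn `i.2` at time `i.1`. -/
abbrev inputSigma (X : ℕ → Fin U → Ω → ℤ) (V : ℕ → Fin U → Ω → ℝ) (i : ℕ × Fin U) :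
    MeasurableSpace Ω :=
  MeasurableSpace.comap (fun ω => (X i.1 i.2 ω, V i.1 i.2 ω)) inferInstance

/-- The input `X`, with all values other than `1` replaced by `-1`. -/
def signInput (X : ℕ → Fin U → Ω → ℤ) (i : ℕ × Fin U) (ω : Ω) : ℤ :=
  if X i.1 i.2 ω = 1 then 1 else -1

theorem signInput_eq_one {i : ℕ × Fin U} {ω : Ω} : signInput X i ω = 1 ↔ X i.1 i.2 ω = 1 := by
  unfold signInput; split_ifs with h <;> simp [h]

theorem signInput_eq_neg_one {i : ℕ × Fin U} {ω : Ω} :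
    signInput X i ω = -1 ↔ X i.1 i.2 ω ≠ 1 := by
  unfold signInput; split_ifs with h <;> simp [h]

theorem measurable_fst_inputSigma (i : ℕ × Fin U) : Measurable[inputSigma X V i] (X i.1 i.2) :=
  measurable_fst.comp (comap_measurable _)

theorem measurable_snd_inputSigma (i : ℕ × Fin U) : Measurable[inputSigma X V i] (V i.1 i.2) :=
  measurable_snd.comp (comap_measurable _)

theorem measurable_signInput (i : ℕ × Fin U) : Measurable[inputSigma X V i] (signInput X i) :=
  (measurable_from_top (f := fun z : ℤ => if z = 1 then (1 : ℤ) else -1)).comp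
    (measurable_fst_inputSigma i)

variable [MeasurableSpace Ω] {P : Measure Ω}

theorem IsUrnInput.measure_X_eq_one (h : IsUrnInput P (1 / 2) X V) (n : ℕ) (u : Fin U) :
    P (X n u ⁻¹' {1}) = 2⁻¹ := by
  rw [← Measure.map_apply (h.measurable_X n u) (measurableSet_singleton 1), h.law_X]
  simp

/-- The map `φ` is there to cover both colours at once: the identity serves black, the reflection `1
- x` serves white. -/
theorem IsUrnInput.isDrive [IsProbabilityMeasure P] (h : IsUrnInput P (1 / 2) X V) {φ : ℝ → ℝ}
    (hφ : MeasurePreserving φ (volume.restrict (Set.Icc 0 1)) (volume.restrict (Set.Icc 0 1))) :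
    IsDrive P (inputSigma X V) (signInput X) (fun i ω => φ (V i.1 i.2 ω)) := by
  have hlaw : ∀ (i : ℕ × Fin U) (A : Set ℝ), MeasurableSet A →
      P {ω | φ (V i.1 i.2 ω) ∈ A} = volume (A ∩ Set.Icc 0 1) := by
    intro i A hA
    have h1 : MeasurePreserving (fun ω => φ (V i.1 i.2 ω)) P (volume.restrict (Set.Icc 0 1)) :=
      hφ.comp ⟨h.measurable_V _ _, h.law_V _ _⟩
    rw [← Measure.restrict_apply hA]
    exact h1.measure_preimage hA.nullMeasurableSet
  refine ⟨fun i => ((h.measurable_X _ _).prodMk (h.measurable_V _ _)).comap_le,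
    iIndepFun_prodMk (fun i => h.measurable_X _ _) (fun i => h.measurable_V _ _) h.indep_X h.indep_V
      h.indep_X_V, measurable_signInput, fun i => hφ.measurable.comp (measurable_snd_inputSigma i),
    fun i ω => ?_, fun i => ?_, fun i t ht0 ht1 => ?_, fun i => ?_⟩
  -- `X` takes the values `±1` only almost surely, while this field asks for every `ω`. Replacing
  -- other values by `-1` is harmless, since `urnStep` treats everything different from `1` as an
  -- own draw.
  · unfold signInput; split_ifs <;> simp
  · have hm : MeasurableSet (X i.1 i.2 ⁻¹' {1}) := h.measurable_X _ _ (measurableSet_singleton 1)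
    have h1 : (fun ω => (signInput X i ω : ℝ)) =
        fun ω => 2 * (X i.1 i.2 ⁻¹' {1}).indicator (1 : Ω → ℝ) ω - 1 := by
      ext ω
      by_cases hω : X i.1 i.2 ω = 1
      · simp [signInput, hω]; norm_num
      · simp [signInput, hω]
    have h2 : Integrable ((X i.1 i.2 ⁻¹' {1}).indicator (1 : Ω → ℝ)) P :=
      (integrable_const (1 : ℝ)).indicator hm
    rw [h1, integral_sub (h2.const_mul 2) (integrable_const _), integral_const_mul,
      integral_indicator_one hm, measureReal_def, h.measure_X_eq_one]
    simp
  · have h1 := hlaw i (Set.Ici (1 - t)) measurableSet_Ici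
    have h2 : {ω | 1 - t ≤ φ (V i.1 i.2 ω)} = {ω | φ (V i.1 i.2 ω) ∈ Set.Ici (1 - t)} := rfl
    rw [h2, h1]
    have h3 : Set.Ici (1 - t) ∩ Set.Icc 0 1 ⊆ Set.Icc (1 - t) 1 := fun x hx => ⟨hx.1, hx.2.2⟩
    refine (measure_mono h3).trans ?_
    rw [Real.volume_Icc, sub_sub_cancel]
  · have hind : IndepFun (X i.1 i.2) (V i.1 i.2) P :=
      h.indep_X_V.comp (φ := fun x : ℕ × Fin U → ℤ => x i) (ψ := fun x : ℕ × Fin U → ℝ => x i)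
        (measurable_pi_apply i) (measurable_pi_apply i)
    have h1 := hind.measure_inter_preimage_eq_mul {1} (φ ⁻¹' Set.Iio (1 / 2))
      (measurableSet_singleton 1) (hφ.measurable measurableSet_Iio)
    have h2 : P (V i.1 i.2 ⁻¹' (φ ⁻¹' Set.Iio (1 / 2))) = 2⁻¹ := by
      refine (hlaw i (Set.Iio (1 / 2)) measurableSet_Iio).trans ?_
      have : Set.Iio (1 / 2 : ℝ) ∩ Set.Icc 0 1 = Set.Ico 0 (1 / 2) := by
        ext x
        simp only [Set.mem_inter_iff, Set.mem_Iio, Set.mem_Icc, Set.mem_Ico]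
        exact ⟨fun hx => ⟨hx.2.1, hx.1⟩, fun hx => ⟨hx.2, hx.1, by linarith [hx.2]⟩⟩
      rw [this, Real.volume_Ico, sub_zero, one_div, ENNReal.ofReal_inv_of_pos two_pos]
      simp
    have h3 : {ω | signInput X i ω = 1 ∧ φ (V i.1 i.2 ω) < 1 / 2} =
        X i.1 i.2 ⁻¹' {1} ∩ V i.1 i.2 ⁻¹' (φ ⁻¹' Set.Iio (1 / 2)) := by
      ext ω
      simp [signInput_eq_one]
    rw [h3, h1, h2, h.measure_X_eq_one, ← ENNReal.mul_inv (by simp) (by simp)]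
    norm_num

theorem measurePreserving_one_sub :
    MeasurePreserving (fun x : ℝ => 1 - x) (volume.restrict (Set.Icc 0 1))
      (volume.restrict (Set.Icc 0 1)) := by
  have h1 := (Measure.measurePreserving_sub_left (volume : Measure ℝ) 1).restrict_preimage
    (measurableSet_Icc (a := (0 : ℝ)) (b := 1))
  simpa using h1

end Input

/-! ### The urn differences as driven walks -/

section RandomExcess

variable {U : ℕ}

/-- The number of black balls minus the number of white balls in urn `u` at time `n`. -/
def excess (r : ℕ → Fin U → ℕ) (n : ℕ) (u : Fin U) : ℤ := 2 * (r n u : ℤ) - n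

theorem IsUrnPath.excess_eq {r : ℕ → Fin U → ℕ} (h : IsUrnPath r) (n : ℕ) (u : Fin U) :
    excess r n u = (r n u : ℤ) - whiteCount r n u := by
  have := h.le n u
  unfold excess whiteCount
  omega

theorem IsUrnPath.sum_excess {r : ℕ → Fin U → ℕ} (h : IsUrnPath r) (n : ℕ) :
    ∑ u, excess r n u = (totalBlack r n : ℤ) - totalWhite r n := by
  simp only [h.excess_eq, Finset.sum_sub_distrib, totalBlack, totalWhite, Nat.cast_sum]

theorem excess_succ_eq_add_iff {r : ℕ → Fin U → ℕ} {n : ℕ} {u : Fin U} :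
    excess r (n + 1) u = excess r n u + 1 ↔ r (n + 1) u = r n u + 1 := by
  unfold excess; push_cast; omega

theorem excess_succ_eq_sub_iff {r : ℕ → Fin U → ℕ} {n : ℕ} {u : Fin U} :
    excess r (n + 1) u = excess r n u - 1 ↔ r (n + 1) u = r n u := by
  unfold excess; push_cast; omega

variable {ρ : ℝ} {x : ℕ → Fin U → ℤ} {v : ℕ → Fin U → ℝ}

theorem excess_urnProcess_succ (hρ : 1 < ρ) (n : ℕ) (u : Fin U) :
    excess (urnProcess (fun i => ρ ^ i) x v) (n + 1) u =
      if v n u < expDraw ρ (if x n u = 1 then ∑ w, excess (urnProcess (fun i => ρ ^ i) x v) n w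
        else excess (urnProcess (fun i => ρ ^ i) x v) n u)
      then excess (urnProcess (fun i => ρ ^ i) x v) n u + 1
      else excess (urnProcess (fun i => ρ ^ i) x v) n u - 1 := by
  have hp := isUrnPath_urnProcess (fun i => ρ ^ i) x v
  have h1 := urnProcess_succ (fun i => ρ ^ i) x v n u
  rw [drawProb_pow hρ, drawProb_pow hρ, ← hp.sum_excess, ← hp.excess_eq] at h1
  split_ifs at h1 ⊢ <;>
    first | exact excess_succ_eq_add_iff.2 h1 | exact excess_succ_eq_sub_iff.2 h1

variable {Ω : Type*} {X : ℕ → Fin U → Ω → ℤ} {V : ℕ → Fin U → Ω → ℝ}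

/-- The excess of black balls of the random urn process. -/
noncomputable def randomExcess (ρ : ℝ) (X : ℕ → Fin U → Ω → ℤ) (V : ℕ → Fin U → Ω → ℝ) (n : ℕ)
    (u : Fin U) (ω : Ω) : ℤ :=
  excess (urnProcess (fun i => ρ ^ i) (fun n u => X n u ω) (fun n u => V n u ω)) n u

theorem measurable_randomExcess (hρ : 1 < ρ) (n : ℕ) (u : Fin U) :
    Measurable[past (inputSigma X V) n] (randomExcess ρ X V n u) := by
  induction n generalizing u with
  | zero => exact measurable_const (a := (2 * ((0 : ℕ) : ℤ) - (0 : ℕ) : ℤ))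
  | succ n ih =>
    have ih' : ∀ u, Measurable[past (inputSigma X V) (n + 1)] (randomExcess ρ X V n u) := fun u =>
      (ih u).mono (past_mono (Nat.le_succ n)) le_rfl
    have hX : Measurable[past (inputSigma X V) (n + 1)] (X n u) :=
      (measurable_fst_inputSigma (n, u)).mono (le_past (Nat.lt_succ_self n)) le_rfl
    have hV : Measurable[past (inputSigma X V) (n + 1)] (V n u) :=
      (measurable_snd_inputSigma (n, u)).mono (le_past (Nat.lt_succ_self n)) le_rfl
    have h1 : randomExcess ρ X V (n + 1) u = fun ω =>
        if V n u ω < expDraw ρ (if X n u ω = 1 then ∑ w, randomExcess ρ X V n w ω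
          else randomExcess ρ X V n u ω)
        then randomExcess ρ X V n u ω + 1 else randomExcess ρ X V n u ω - 1 := by
      ext ω
      exact excess_urnProcess_succ hρ n u
    rw [h1]
    have h2 : Measurable[past (inputSigma X V) (n + 1)] fun ω =>
        if X n u ω = 1 then ∑ w, randomExcess ρ X V n w ω else randomExcess ρ X V n u ω :=
      Measurable.ite (hX (measurableSet_singleton 1)) (Finset.measurable_sum _ fun w _ => ih' w)
        (ih' u)
    have h3 : Measurable[past (inputSigma X V) (n + 1)] fun ω => expDraw ρ
        (if X n u ω = 1 then ∑ w, randomExcess ρ X V n w ω else randomExcess ρ X V n u ω) :=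
      (measurable_from_top (f := expDraw ρ)).comp h2
    have h4 : MeasurableSet[past (inputSigma X V) (n + 1)] {ω | V n u ω < expDraw ρ
        (if X n u ω = 1 then ∑ w, randomExcess ρ X V n w ω else randomExcess ρ X V n u ω)} :=
      (hV.prodMk h3) (measurableSet_lt measurable_fst measurable_snd)
    exact Measurable.ite h4 ((ih' u).add_const 1) ((ih' u).sub_const 1)

theorem isDrivenWalk_randomExcess (hρ : 1 < ρ) (ω : Ω) :
    IsDrivenWalk (expDraw ρ) (fun i => signInput X i ω) (fun i => V i.1 i.2 ω)
      (fun n u => randomExcess ρ X V n u ω) := by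
  refine ⟨fun n u => ?_, fun i => ?_, fun n u hx hv => ?_, fun n u hx hv => ?_⟩
  · have h := excess_urnProcess_succ (x := fun n u => X n u ω) (v := fun n u => V n u ω) hρ n u
    exact (em _).imp (fun hc => h.trans (if_pos hc)) fun hc => h.trans (if_neg hc)
  · unfold signInput; split_ifs <;> simp
  · refine (excess_urnProcess_succ hρ n u).trans (if_pos ?_)
    rw [if_pos (signInput_eq_one.1 hx)]
    exact hv
  · refine (excess_urnProcess_succ hρ n u).trans (if_pos ?_)
    rw [if_neg (signInput_eq_neg_one.1 hx)]
    exact hv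

/-- Exchanging the colours turns `V` into `1 - V`. -/
theorem isDrivenWalk_neg_randomExcess (hρ : 1 < ρ) (ω : Ω) :
    IsDrivenWalk (expDraw ρ) (fun i => signInput X i ω) (fun i => 1 - V i.1 i.2 ω)
      (fun n u => -randomExcess ρ X V n u ω) := by
  have hdown : ∀ n u, ¬ V n u ω < expDraw ρ (if X n u ω = 1 then ∑ w, randomExcess ρ X V n w ω
        else randomExcess ρ X V n u ω) →
      -randomExcess ρ X V (n + 1) u ω = -randomExcess ρ X V n u ω + 1 := by
    intro n u hc
    have h : randomExcess ρ X V (n + 1) u ω = randomExcess ρ X V n u ω - 1 :=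
      (excess_urnProcess_succ hρ n u).trans (if_neg hc)
    omega
  refine ⟨fun n u => ?_, (isDrivenWalk_randomExcess hρ ω (V := V)).sign, fun n u hx hv => ?_,
    fun n u hx hv => ?_⟩
  · rcases (isDrivenWalk_randomExcess (X := X) (V := V) hρ ω).step n u with h | h
    · right; omega
    · left; omega
  · refine hdown n u ?_
    rw [if_pos (signInput_eq_one.1 hx)]
    rw [Finset.sum_neg_distrib, expDraw_neg hρ] at hv
    linarith
  · refine hdown n u ?_
    rw [if_neg (signInput_eq_neg_one.1 hx)]
    rw [expDraw_neg hρ] at hv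
    linarith

end RandomExcess

end InteractingUrns

/-! ### Conclusion for both colours -/

open Filter InteractingUrns in
theorem theorem3p5 (U : ℕ) (ρ : ℝ) (hρ : 1 < ρ)
    {Ω : Type*} [MeasurableSpace Ω] (P : MeasureTheory.Measure Ω)
    [MeasureTheory.IsProbabilityMeasure P]
    (X : ℕ → Fin U → Ω → ℤ) (V : ℕ → Fin U → Ω → ℝ)
    (hXV : InteractingUrns.IsUrnInput P (1 / 2) X V) :
    ∀ᵐ ω ∂P, ∃ n₀ : ℕ, ∃ d : InteractingUrns.Color, ∀ n ≥ n₀, ∀ u : Fin U,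
      InteractingUrns.addedColor
        (InteractingUrns.urnProcess (fun i => ρ ^ i)
          (fun n u => X n u ω) (fun n u => V n u ω)) n u = d := by
  have hr0 : 0 ≤ (√ρ)⁻¹ := by positivity
  have hr1 : (√ρ)⁻¹ < 1 := inv_lt_one_of_one_lt₀ (Real.lt_sqrt_of_sq_lt (by simpa using hρ))
  have hup := (hXV.isDrive (MeasurePreserving.id _)).ae_eventually_up hr0 hr1 (half_le_expDraw hρ)
    (one_sub_pow_le_expDraw hρ) (measurable_randomExcess hρ) (isDrivenWalk_randomExcess hρ)
  have hdown := (hXV.isDrive measurePreserving_one_sub).ae_eventually_up hr0 hr1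
    (half_le_expDraw hρ) (one_sub_pow_le_expDraw hρ)
    (fun n u => (measurable_randomExcess hρ n u).neg) (isDrivenWalk_neg_randomExcess hρ)
  filter_upwards [hup, hdown] with ω hup hdown
  -- At each time the total excess or its negative is nonnegative, so at least one of the two
  -- alternatives occurs infinitely often.
  have hor : (∃ᶠ n in atTop, 0 ≤ ∑ u, randomExcess ρ X V n u ω) ∨
      ∃ᶠ n in atTop, 0 ≤ ∑ u, -randomExcess ρ X V n u ω := by
    rw [← frequently_or_distrib]
    refine Frequently.of_forall fun n => ?_
    rw [Finset.sum_neg_distrib]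
    omega
  rcases hor with hio | hio
  · obtain ⟨m, hm⟩ := hup hio
    exact ⟨m, Color.black, fun n hn u => if_pos (excess_succ_eq_add_iff.1 (hm n hn u))⟩
  · obtain ⟨m, hm⟩ := hdown hio
    refine ⟨m, Color.white, fun n hn u => if_neg ?_⟩
    have h1 : -randomExcess ρ X V (n + 1) u ω = -randomExcess ρ X V n u ω + 1 := hm n hn u
    have h2 : randomExcess ρ X V (n + 1) u ω = randomExcess ρ X V n u ω - 1 := by omega
    have h3 := excess_succ_eq_sub_iff.1 h2
    omega
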